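/- Let $n$ be a nonnegative integer and let $\mathrm{M}_n$ be the algebra of complex $n\times n$ matrices, regarded as a real Euclidean space with the scalar product $(A,B)\mapsto\operatorname{Re}\langle A,B\rangle$, where $\langle A,B\rangle=\operatorname{tr}(A^*B)$. A real matrix system on $\mathbb{C}^n$ is a real linear subspace $\mathcal{R}\subset\mathrm{M}_n$ that contains the identity matrix and satisfies $A^*\in\mathcal{R}$ for every $A\in\mathcal{R}$. Its set of density matrices is $$\mathcal{D}(\mathcal{R})=\{\rho\in\mathcal{R}:\ \rho^*=\rho,\ \operatorname{tr}\rho=1,\ \langle\rho,B\rangle\ge 0\text{ for every positive semidefinite }B\in\mathcal{R}\},$$ endowed with the relative topology of $\mathrm{M}_n$. If $\mathcal{R}_2\subset\mathcal{R}_1$ are real matrix systems on $\mathbb{C}^n$, then the orthogonal projection $\pi:\mathcal{R}_1\to\mathcal{R}_2$, determined by $\operatorname{Re}\langle A-\pi(A),B\rangle=0$ for all $A\in\mathcal{R}_1$ and $B\in\mathcal{R}_2$, maps $\mathcal{D}(\mathcal{R}_1)$ into $\mathcal{D}(\mathcal{R}_2)$; its restriction $\mathcal{D}(\mathcal{R}_1)\to\mathcal{D}(\mathcal{R}_2)$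 is called the orthogonal projection of $\mathcal{D}(\mathcal{R}_1)$ onto $\mathcal{D}(\mathcal{R}_2)$. Proposition. Let $\mathrm{M}_n(\mathbb{R})\subset\mathrm{M}_n$ be the real matrix system of matrices with real entries. The orthogonal projection $\mathcal{D}(\mathrm{M}_n)\to\mathcal{D}(\mathrm{M}_n(\mathbb{R}))$ is the entrywise real part, $\rho\mapsto(\operatorname{Re}\rho_{ij})_{i,j}$, and it is an open map: it maps every relatively open subset of $\mathcal{D}(\mathrm{M}_n)$ to a relatively open subset of $\mathcal{D}(\mathrm{M}_n(\mathbb{R}))$. -/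

import Mathlib

open scoped ComplexOrder Matrix

noncomputable section

namespace DensityMatrices

/-- The full matrix algebra of complex `n × n` matrices. -/
abbrev Mat (n : ℕ) : Type := Matrix (Fin n) (Fin n) ℂ

/-- The Frobenius inner product `⟨A, B⟩ = tr (A* B)`. -/
def frob {n : ℕ} (A B : Mat n) : ℂ := (Aᴴ * B).trace

/-- The Euclidean scalar product `(A, B) ↦ Re ⟨A, B⟩` on the real vector space of complex
`n × n` matrices. -/
def euclideanForm (n : ℕ) : LinearMap.BilinForm ℝ (Mat n) :=
  LinearMap.mk₂ ℝ (fun A B => (frob A B).re)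
    (fun A A' B => by simp [frob, Matrix.add_mul])
    (fun r A B => by simp [frob])
    (fun A B B' => by simp [frob, Matrix.mul_add])
    (fun r A B => by simp [frob])

theorem euclideanForm_apply {n : ℕ} (A B : Mat n) : euclideanForm n A B = (frob A B).re := rfl

theorem frob_swap {n : ℕ} (A B : Mat n) : frob B A = star (frob A B) := by
  rw [frob, frob, ← Matrix.trace_conjTranspose, Matrix.conjTranspose_mul,
    Matrix.conjTranspose_conjTranspose]

theorem euclideanForm_comm {n : ℕ} (A B : Mat n) : euclideanForm n A B = euclideanForm n B A := by
  rw [euclideanForm_apply, euclideanForm_apply, frob_swap A B, RCLike.star_def, Complex.conj_re]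

theorem eq_zero_of_euclideanForm_self {n : ℕ} (A : Mat n) (h : euclideanForm n A A = 0) :
    A = 0 := by
  have him : (frob A A).im = 0 := by
    have h1 := congrArg Complex.im (frob_swap A A)
    rw [RCLike.star_def, Complex.conj_im] at h1
    linarith
  exact Matrix.trace_conjTranspose_mul_self_eq_zero_iff.1 (Complex.ext h him)

/-- Every real subspace of the matrices is complemented by its orthogonal complement. -/
theorem isCompl_orthogonal {n : ℕ} (S : Submodule ℝ (Mat n)) :
    IsCompl S ((euclideanForm n).orthogonal S) := by
  have hrefl : (euclideanForm n).IsRefl := fun A B h => by rw [euclideanForm_comm, h]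
  apply LinearMap.BilinForm.isCompl_orthogonal_of_restrict_nondegenerate hrefl
  refine ⟨fun A h => ?_, fun A h => ?_⟩ <;>
    exact Subtype.ext (eq_zero_of_euclideanForm_self _ (h A))

/-- A real matrix system on `ℂⁿ`: a real linear subspace of the complex `n × n` matrices that is
self-adjoint and contains the identity matrix. -/
structure RealMatrixSystem (n : ℕ) where
  toSubmodule : Submodule ℝ (Mat n)
  conjTranspose_mem : ∀ A ∈ toSubmodule, Aᴴ ∈ toSubmodule
  one_mem : (1 : Mat n) ∈ toSubmodule

/-- The full matrix algebra `M_n`. -/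
def fullSystem (n : ℕ) : RealMatrixSystem n where
  toSubmodule := ⊤
  conjTranspose_mem _ _ := Submodule.mem_top
  one_mem := Submodule.mem_top

/-- The algebra `M_n(ℝ)` of matrices with real entries, as a subset of `M_n`. -/
def realSystem (n : ℕ) : RealMatrixSystem n where
  toSubmodule :=
    { carrier := {A | ∀ i j, (A i j).im = 0}
      add_mem' := fun {A B} hA hB i j => by simp [hA i j, hB i j]
      zero_mem' := fun i j => by simp
      smul_mem' := fun r A hA i j => by simp [hA i j] }
  conjTranspose_mem A hA i j := by simpa using hA j i
  one_mem i j := by by_cases h : i = j <;> simp [Matrix.one_apply, h]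

theorem realSystem_le (n : ℕ) : (realSystem n).toSubmodule ≤ (fullSystem n).toSubmodule :=
  le_top

/-- The hermitian matrices `H(R)` in `R`. -/
def hermitianPart {n : ℕ} (R : RealMatrixSystem n) : Set (Mat n) :=
  {A | A ∈ R.toSubmodule ∧ Aᴴ = A}

/-- The cone `C(R)` of positive semidefinite matrices in `R`. -/
def posCone {n : ℕ} (R : RealMatrixSystem n) : Set (Mat n) :=
  {A | A ∈ R.toSubmodule ∧ A.PosSemidef}

/-- The dual cone of `C(R)` in `H(R)`. The order on `ℂ` is the usual one, so `0 ≤ z` means that `z`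
is real and nonnegative. -/
def dualCone {n : ℕ} (R : RealMatrixSystem n) : Set (Mat n) :=
  {A | A ∈ hermitianPart R ∧ ∀ B ∈ posCone R, 0 ≤ frob A B}

/-- The set `D(R)` of density matrices of `R`. As a type, it has the subspace topology. -/
def density {n : ℕ} (R : RealMatrixSystem n) : Set (Mat n) :=
  {A | A ∈ dualCone R ∧ A.trace = 1}

/-- The orthogonal projection of `R` onto a real matrix system `S` (contained in `R`), with respect
to the Euclidean scalar product. It is the restriction to `R` of the orthogonal projection of `M_n`
onto `S`. -/
def orthProj {n : ℕ} (R S : RealMatrixSystem n) : R.toSubmodule →ₗ[ℝ] S.toSubmodule :=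
  Submodule.projectionOnto S.toSubmodule ((euclideanForm n).orthogonal S.toSubmodule)
    (isCompl_orthogonal S.toSubmodule) ∘ₗ R.toSubmodule.subtype

theorem orthProj_unique {n : ℕ} (R S : RealMatrixSystem n) (A : R.toSubmodule) (C : Mat n)
    (hC : C ∈ S.toSubmodule)
    (h : ∀ B ∈ S.toSubmodule, (frob ((A : Mat n) - C) B).re = 0) :
    (orthProj R S A : Mat n) = C := by
  have h1 : (A : Mat n) - C ∈ (euclideanForm n).orthogonal S.toSubmodule := by
    intro B hB
    change euclideanForm n B _ = 0
    rw [euclideanForm_comm]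
    exact h B hB
  have h2 := (Submodule.projectionOnto_apply_eq_zero_iff (isCompl_orthogonal S.toSubmodule)).2 h1
  rw [map_sub, Submodule.projectionOnto_apply_of_mem_left _ hC, sub_eq_zero] at h2
  exact congrArg Subtype.val h2

/-- The equations that specify the orthogonal projection. -/
theorem orthProj_spec {n : ℕ} (R S : RealMatrixSystem n) (A : R.toSubmodule) (B : Mat n)
    (hB : B ∈ S.toSubmodule) : (frob ((A : Mat n) - (orthProj R S A : Mat n)) B).re = 0 := by
  have h1 : (A : Mat n) - (orthProj R S A : Mat n) ∈
      (euclideanForm n).orthogonal S.toSubmodule := by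
    rw [← Submodule.projectionOnto_apply_eq_zero_iff (isCompl_orthogonal S.toSubmodule), map_sub,
      Submodule.projectionOnto_apply_left]
    exact sub_self _
  have h2 := h1 B hB
  change euclideanForm n B _ = 0 at h2
  rwa [euclideanForm_comm] at h2

theorem frob_conjTranspose {n : ℕ} (A B : Mat n) : frob Aᴴ Bᴴ = star (frob A B) := by
  rw [← frob_swap, frob, frob, Matrix.conjTranspose_conjTranspose, Matrix.trace_mul_comm]

theorem frob_im {n : ℕ} {A B : Mat n} (hA : Aᴴ = A) (hB : Bᴴ = B) : (frob A B).im = 0 := by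
  have h := congrArg Complex.im (frob_conjTranspose A B)
  rw [hA, hB, RCLike.star_def, Complex.conj_im] at h
  linarith

theorem frob_sub {n : ℕ} (A B C : Mat n) : frob (A - B) C = frob A C - frob B C := by
  simp [frob, Matrix.sub_mul]

/-- The orthogonal projection of `R` onto `S ⊆ R` maps density matrices to density matrices. -/
theorem orthProj_mem_density {n : ℕ} (R S : RealMatrixSystem n)
    (h : S.toSubmodule ≤ R.toSubmodule) (A : R.toSubmodule) (hA : (A : Mat n) ∈ density R) :
    (orthProj R S A : Mat n) ∈ density S := by
  obtain ⟨⟨⟨_, hAh⟩, hpos⟩, htr⟩ := hA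
  have hherm : (orthProj R S A : Mat n)ᴴ = (orthProj R S A : Mat n) := by
    refine (orthProj_unique R S A _ (S.conjTranspose_mem _ (orthProj R S A).2) ?_).symm
    intro B hB
    have h1 := orthProj_spec R S A Bᴴ (S.conjTranspose_mem B hB)
    have h2 := frob_conjTranspose ((A : Mat n) - (orthProj R S A : Mat n)) Bᴴ
    rw [Matrix.conjTranspose_sub, hAh, Matrix.conjTranspose_conjTranspose] at h2
    rw [h2, RCLike.star_def, Complex.conj_re, h1]
  have hfrob : ∀ B ∈ S.toSubmodule, Bᴴ = B →
      frob (orthProj R S A : Mat n) B = frob (A : Mat n) B := by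
    intro B hB hBh
    have h1 := orthProj_spec R S A B hB
    rw [frob_sub, Complex.sub_re] at h1
    apply Complex.ext
    · linarith
    · rw [frob_im hherm hBh, frob_im hAh hBh]
  refine ⟨⟨⟨(orthProj R S A).2, hherm⟩, ?_⟩, ?_⟩
  · rintro B ⟨hB, hBp⟩
    rw [hfrob B hB hBp.1]
    exact hpos B ⟨h hB, hBp⟩
  · have h1 := hfrob 1 S.one_mem Matrix.conjTranspose_one
    simpa [frob, hherm, hAh, htr] using h1

/-- The orthogonal projection `D(R) → D(S)`, where `S ⊆ R`: the restriction of the orthogonal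
projection `R → S`. -/
def densityProj {n : ℕ} (R S : RealMatrixSystem n) (h : S.toSubmodule ≤ R.toSubmodule)
    (A : density R) : density S :=
  ⟨(orthProj R S ⟨A.1, A.2.1.1.1⟩ : Mat n), orthProj_mem_density R S h ⟨A.1, A.2.1.1.1⟩ A.2⟩

end DensityMatrices

end

namespace DensityMatrices

open scoped ComplexOrder Matrix MatrixOrder Matrix.Norms.L2Operator
open Filter Topology

variable {n : ℕ}

/-! A map is open if every point `ρ` of its domain lies on a section that is continuous at the image
of `ρ`. Let `A` be the real part of `ρ` and write `ρ = √A X √A` with `X ≥ 0` and `Re X = 1`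
(`exists_sqrt_rePart_mul`). The section is `C ↦ √C X √C`. It is continuous because the square root
is, and it takes the value `ρ` at `A`. Since `√C` is real, the real part of `√C X √C` is `√C (Re X)
√C = C` (`sqrt_mul_mem_density`). -/

/-- Entrywise complex conjugation. -/
noncomputable def conjMat : Mat n →+* Mat n := (starRingEnd ℂ).mapMatrix

/-- The entrywise real part. -/
def rePart (A : Mat n) : Mat n := A.map fun z : ℂ => (z.re : ℂ)

theorem conjMat_apply (A : Mat n) (i j : Fin n) : conjMat A i j = star (A i j) := rfl

theorem conjMat_eq_transpose {A : Mat n} (h : Aᴴ = A) : conjMat A = Aᵀ := by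
  conv_rhs => rw [← h]
  rfl

theorem posSemidef_conjMat {A : Mat n} (h : A.PosSemidef) : (conjMat A).PosSemidef :=
  conjMat_eq_transpose h.1 ▸ h.transpose

theorem rePart_eq (A : Mat n) : rePart A = (2⁻¹ : ℂ) • (A + conjMat A) := by
  ext i j
  simp only [rePart, Matrix.map_apply, Matrix.smul_apply, Matrix.add_apply, conjMat_apply,
    smul_eq_mul, RCLike.star_def, Complex.add_conj]
  push_cast
  ring

theorem continuous_rePart : Continuous (rePart : Mat n → Mat n) :=
  continuous_id.matrix_map (by fun_prop)

theorem rePart_add (A B : Mat n) : rePart (A + B) = rePart A + rePart B := by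
  ext i j; simp [rePart]

theorem rePart_smul_one (r : ℝ) : rePart (r • (1 : Mat n)) = r • 1 := by
  ext i j; by_cases h : i = j <;> simp [rePart, h]

/-- Conjugation is a ring homomorphism that fixes `Q`. -/
theorem rePart_conj {Q : Mat n} (hQ : conjMat Q = Q) (X : Mat n) :
    rePart (Q * X * Q) = Q * rePart X * Q := by
  simp only [rePart_eq, map_mul, hQ, Matrix.mul_smul, Matrix.smul_mul, Matrix.mul_add,
    Matrix.add_mul]

theorem conjMat_rePart (A : Mat n) : conjMat (rePart A) = rePart A := by
  ext i j; simp [conjMat_apply, rePart]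

theorem mem_realSystem_iff {A : Mat n} : A ∈ (realSystem n).toSubmodule ↔ conjMat A = A := by
  change (∀ i j, (A i j).im = 0) ↔ _
  simp only [← Matrix.ext_iff, conjMat_apply, RCLike.star_def, Complex.conj_eq_iff_im]

theorem posSemidef_rePart {A : Mat n} (h : A.PosSemidef) : (rePart A).PosSemidef := by
  rw [rePart_eq]
  exact (h.add (posSemidef_conjMat h)).smul (by positivity)

theorem frob_nonneg {A B : Mat n} (hA : A.PosSemidef) (hB : B.PosSemidef) : 0 ≤ frob A B := by
  have h : CFC.sqrt B * CFC.sqrt B = B := CFC.sqrt_mul_sqrt_self B hB.nonneg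
  have hs : (CFC.sqrt B).PosSemidef := Matrix.nonneg_iff_posSemidef.1 (CFC.sqrt_nonneg B)
  have := (hA.conjTranspose_mul_mul_same (CFC.sqrt B)).trace_nonneg
  rw [hs.1.eq] at this
  rwa [frob, hA.1.eq, ← h, ← Matrix.mul_assoc, Matrix.trace_mul_comm, ← Matrix.mul_assoc]

theorem mem_density_fullSystem {A : Mat n} :
    A ∈ density (fullSystem n) ↔ A.PosSemidef ∧ A.trace = 1 := by
  refine ⟨fun h => ⟨.of_dotProduct_mulVec_nonneg h.1.1.2 fun x => ?_, h.2⟩, fun h =>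
    ⟨⟨⟨Submodule.mem_top, h.1.1⟩, fun B hB => frob_nonneg h.1 hB.2⟩, h.2⟩⟩
  -- Testing against the rank-one matrix `x x*` gives the quadratic form at `x`.
  have := h.1.2 _ ⟨Submodule.mem_top, Matrix.posSemidef_vecMulVec_self_star x⟩
  rwa [frob, h.1.1.2, Matrix.mul_vecMulVec, Matrix.trace_vecMulVec, dotProduct_comm] at this

/-- For a real symmetric `A`, pairing with a positive semidefinite `B` gives the same value as
pairing with `Re B`, which is again positive semidefinite. Hence testing against real matrices
suffices, and elements of `D(M_n(ℝ))` have square roots. -/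
theorem density_realSystem_subset : density (realSystem n) ⊆ density (fullSystem n) := by
  rintro A ⟨⟨⟨hA, hAh⟩, hpos⟩, htr⟩
  refine ⟨⟨⟨Submodule.mem_top, hAh⟩, fun B hB => ?_⟩, htr⟩
  have hA' := mem_realSystem_iff.1 hA
  have h1 := hpos (rePart B) ⟨mem_realSystem_iff.2 (conjMat_rePart B), posSemidef_rePart hB.2⟩
  have h2 : frob A (conjMat B) = star (frob A B) := by
    have h : A * conjMat B = conjMat (A * B) := by rw [map_mul, hA']
    rw [frob, frob, hAh, h]
    exact (map_sum (starRingEnd ℂ) _ _).symm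
  have h3 : frob A (rePart B) = frob A B := by
    rw [rePart_eq, frob, Matrix.mul_smul, Matrix.mul_add, Matrix.trace_smul, Matrix.trace_add]
    change (2⁻¹ : ℂ) • (frob A B + frob A (conjMat B)) = _
    rw [h2, RCLike.star_def, Complex.conj_eq_iff_im.2 (frob_im hAh hB.2.1)]
    simp only [smul_eq_mul]; ring
  rwa [h3] at h1

theorem orthProj_realSystem (A : (fullSystem n).toSubmodule) :
    (orthProj (fullSystem n) (realSystem n) A : Mat n) = rePart A := by
  refine orthProj_unique _ _ _ _ (mem_realSystem_iff.2 (conjMat_rePart _)) fun B hB => ?_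
  have hB' : ∀ i j, (B i j).im = 0 := hB
  simp [frob, Matrix.trace, Matrix.mul_apply, rePart, hB']

theorem sqrt_posSemidef (A : Mat n) : (CFC.sqrt A).PosSemidef :=
  Matrix.nonneg_iff_posSemidef.1 (CFC.sqrt_nonneg A)

/-- The conjugate of `√A` is also a positive semidefinite root of `A`, and such a root is unique. -/
theorem conjMat_sqrt {A : Mat n} (hA : A.PosSemidef) (h : conjMat A = A) :
    conjMat (CFC.sqrt A) = CFC.sqrt A := by
  refine (CFC.sqrt_unique ?_ (posSemidef_conjMat (sqrt_posSemidef A)).nonneg).symm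
  rw [← map_mul, CFC.sqrt_mul_sqrt_self A hA.nonneg, h]

theorem isClosed_posSemidef : IsClosed {X : Mat n | X.PosSemidef} := by
  simp only [Matrix.posSemidef_iff_dotProduct_mulVec, Matrix.IsHermitian, Set.ofPred_and,
    Set.ofPred_forall]
  refine (isClosed_eq (by fun_prop) (by fun_prop)).inter (isClosed_iInter fun x => ?_)
  exact isClosed_le continuous_const (by fun_prop)

/-- Boundedness: `0 ≤ X ≤ X + conj X = 2 Re X = 2`. -/
theorem isCompact_posSemidef_rePart_eq_one :
    IsCompact {X : Mat n | X.PosSemidef ∧ rePart X = 1} := by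
  have : ProperSpace (Mat n) := FiniteDimensional.proper ℂ _
  refine (isCompact_closedBall (0 : Mat n) 2).of_isClosed_subset
    (isClosed_posSemidef.inter (isClosed_eq continuous_rePart continuous_const)) ?_
  rintro X ⟨hX, h1⟩
  rw [mem_closedBall_zero_iff, CStarAlgebra.norm_le_iff_le_algebraMap X zero_le_two hX.nonneg,
    Matrix.le_iff]
  have h : algebraMap ℝ (Mat n) 2 - X = conjMat X := by
    rw [sub_eq_iff_eq_add', Algebra.algebraMap_eq_smul_one, ← h1, rePart_eq]
    ext i j
    simp
  exact h ▸ posSemidef_conjMat hX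

/-- Every positive semidefinite `ρ` is `√A X √A`, where `A` is the entrywise real part of `ρ` and
`X` is positive semidefinite with entrywise real part `1`. -/
theorem exists_sqrt_rePart_mul {ρ : Mat n} (hρ : ρ.PosSemidef) :
    ∃ X : Mat n, X.PosSemidef ∧ rePart X = 1 ∧
      CFC.sqrt (rePart ρ) * X * CFC.sqrt (rePart ρ) = ρ := by
  -- `Re ρ` may be singular. Adding `ε k` times the identity makes it invertible, so that `X k` can
  -- be defined by inverting the root `Q k`.
  let ε : ℕ → ℝ := fun k => 1 / ((k : ℝ) + 1)
  have hε : ∀ k, 0 < ε k := fun k => Nat.one_div_pos_of_nat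
  let R : ℕ → Mat n := fun k => ρ + ε k • 1
  have hone : ∀ k, (ε k • (1 : Mat n)).PosDef := fun k => Matrix.PosDef.one.smul (hε k)
  have hR : ∀ k, (R k).PosSemidef := fun k => hρ.add (hone k).posSemidef
  have hre : ∀ k, rePart (R k) = rePart ρ + ε k • 1 := fun k => by
    rw [rePart_add, rePart_smul_one]
  have hpd : ∀ k, (rePart (R k)).PosDef := fun k => by
    rw [hre]; exact Matrix.PosDef.posSemidef_add (posSemidef_rePart hρ) (hone k)
  let Q : ℕ → Mat n := fun k => CFC.sqrt (rePart (R k))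
  have hQQ : ∀ k, Q k * Q k = rePart (R k) := fun k =>
    CFC.sqrt_mul_sqrt_self _ (hpd k).posSemidef.nonneg
  have hQc : ∀ k, conjMat (Q k) = Q k := fun k =>
    conjMat_sqrt (hpd k).posSemidef (conjMat_rePart _)
  have hQh : ∀ k, (Q k)ᴴ = Q k := fun k => (sqrt_posSemidef _).1
  have hQu : ∀ k, IsUnit (Q k).det := fun k => by
    have h := (Matrix.isUnit_iff_isUnit_det _).1 (hpd k).isUnit
    rw [← hQQ, Matrix.det_mul] at h
    exact isUnit_of_mul_isUnit_left h
  have hQi : ∀ k, conjMat (Q k)⁻¹ = (Q k)⁻¹ := fun k => by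
    refine (Matrix.inv_eq_left_inv ?_).symm
    conv_lhs => rw [← hQc k, ← map_mul, hQc k, Matrix.nonsing_inv_mul _ (hQu k), map_one]
  let X : ℕ → Mat n := fun k => (Q k)⁻¹ * R k * (Q k)⁻¹
  have hX : ∀ k, X k ∈ {X : Mat n | X.PosSemidef ∧ rePart X = 1} := fun k => by
    constructor
    · have := (hR k).conjTranspose_mul_mul_same (Q k)⁻¹
      rwa [Matrix.conjTranspose_nonsing_inv, hQh] at this
    · rw [rePart_conj (hQi k), ← hQQ, ← Matrix.mul_assoc, Matrix.nonsing_inv_mul _ (hQu k),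
        Matrix.one_mul, Matrix.mul_nonsing_inv _ (hQu k)]
  have hQX : ∀ k, Q k * X k * Q k = R k := fun k => by
    simp only [X, Matrix.mul_assoc, Matrix.nonsing_inv_mul _ (hQu k), Matrix.mul_one]
    rw [← Matrix.mul_assoc, Matrix.mul_nonsing_inv _ (hQu k), Matrix.one_mul]
  -- The inverses `(Q k)⁻¹` may blow up, but the `X k` stay in a compact set. A limit point `Y`
  -- inherits the factorization from `hQX`.
  obtain ⟨Y, hY, φ, hφ, hlim⟩ := isCompact_posSemidef_rePart_eq_one.tendsto_subseq hX
  refine ⟨Y, hY.1, hY.2, ?_⟩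
  have hRlim : Tendsto R atTop (𝓝 ρ) := by
    have : Tendsto ε atTop (𝓝 0) := tendsto_one_div_add_atTop_nhds_zero_nat
    simpa using tendsto_const_nhds.add (this.smul_const (1 : Mat n))
  have hQlim : Tendsto Q atTop (𝓝 (CFC.sqrt (rePart ρ))) := by
    -- Continuity of the square root is used on the positive cone only, so convergence within the
    -- cone is needed.
    refine ((CFC.continuousOn_sqrt (A := Mat n)) _ (posSemidef_rePart hρ).nonneg).tendsto.comp
      (tendsto_nhdsWithin_iff.2 ⟨(continuous_rePart.tendsto ρ).comp hRlim, ?_⟩)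
    exact Eventually.of_forall fun k => (hpd k).posSemidef.nonneg
  have hQlim' := hQlim.comp hφ.tendsto_atTop
  refine tendsto_nhds_unique ((hQlim'.mul hlim).mul hQlim') ?_
  refine (hRlim.comp hφ.tendsto_atTop).congr fun k => ?_
  exact (hQX (φ k)).symm

theorem trace_rePart {A : Mat n} (hA : Aᴴ = A) : (rePart A).trace = A.trace := by
  rw [rePart_eq, conjMat_eq_transpose hA, Matrix.trace_smul, Matrix.trace_add,
    Matrix.trace_transpose, smul_eq_mul]
  ring

theorem sqrt_mul_mem_density {X : Mat n} (hX : X.PosSemidef) (h1 : rePart X = 1)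
    {C : Mat n} (hC : C ∈ density (realSystem n)) :
    rePart (CFC.sqrt C * X * CFC.sqrt C) = C ∧
      CFC.sqrt C * X * CFC.sqrt C ∈ density (fullSystem n) := by
  have hCp := (mem_density_fullSystem.1 (density_realSystem_subset hC)).1
  have hre : rePart (CFC.sqrt C * X * CFC.sqrt C) = C := by
    rw [rePart_conj (conjMat_sqrt hCp (mem_realSystem_iff.1 hC.1.1.1)), h1, Matrix.mul_one,
      CFC.sqrt_mul_sqrt_self C hCp.nonneg]
  have hpos : (CFC.sqrt C * X * CFC.sqrt C).PosSemidef := by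
    have := hX.conjTranspose_mul_mul_same (CFC.sqrt C)
    rwa [(sqrt_posSemidef C).1.eq] at this
  exact ⟨hre, mem_density_fullSystem.2 ⟨hpos, by rw [← trace_rePart hpos.1, hre, hC.2]⟩⟩

theorem densityProj_realSystem (A : density (fullSystem n)) :
    (densityProj (fullSystem n) (realSystem n) (realSystem_le n) A : Mat n) = rePart A.1 :=
  orthProj_realSystem _

theorem isOpenMap_densityProj_realSystem :
    IsOpenMap (densityProj (fullSystem n) (realSystem n) (realSystem_le n)) := by
  refine IsOpenMap.of_sections fun ρ => ?_
  obtain ⟨X, hX, h1, hρ⟩ := exists_sqrt_rePart_mul (mem_density_fullSystem.1 ρ.2).1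
  refine ⟨fun C => ⟨_, (sqrt_mul_mem_density hX h1 C.2).2⟩, Continuous.continuousAt ?_,
    Subtype.ext ?_, fun C => Subtype.ext ?_⟩
  · have hs : Continuous fun C : density (realSystem n) => CFC.sqrt (C : Mat n) :=
      CFC.continuousOn_sqrt.comp_continuous continuous_subtype_val fun C =>
        (mem_density_fullSystem.1 (density_realSystem_subset C.2)).1.nonneg
    exact ((hs.mul continuous_const).mul hs).subtype_mk _
  · simpa only [densityProj_realSystem] using hρ
  · rw [densityProj_realSystem]
    exact (sqrt_mul_mem_density hX h1 C.2).1

end DensityMatrices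

theorem mainTheorem3 (n : ℕ) :
    (∀ A : DensityMatrices.density (DensityMatrices.fullSystem n),
      (DensityMatrices.densityProj (DensityMatrices.fullSystem n) (DensityMatrices.realSystem n)
        (DensityMatrices.realSystem_le n) A : DensityMatrices.Mat n) =
        A.1.map (fun z : ℂ => (z.re : ℂ))) ∧
    IsOpenMap (DensityMatrices.densityProj (DensityMatrices.fullSystem n)
      (DensityMatrices.realSystem n) (DensityMatrices.realSystem_le n)) :=
  ⟨DensityMatrices.densityProj_realSystem, DensityMatrices.isOpenMap_densityProj_realSystem⟩
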